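/- Let $\Gamma$ be a weighted digraph without loops on the vertex set $V=\{1,\dots,n\}$, $n\ge 1$, with matrix of arc weights $W=(w_{ij})$, where $w_{ij}>0$ if there is an arc from $i$ to $j$ and $w_{ij}=0$ otherwise. Its column Laplacian matrix $L=(l_{ij})$ is given by $l_{ij}=-w_{ij}$ for $j\ne i$ and $l_{ii}=\sum_{k\ne i}w_{ki}$. An out-forest of $\Gamma$ is a spanning subgraph all of whose weak components are diverging trees, that is, each weak component has one vertex (the root) of indegree $0$ and all its other vertices have indegree $1$. The weight of an out-forest is the product of the weights of its arcs (and is $1$ if it has no arcs). Let $\tilde J=(\tilde J_{ij})$ be the stochastic matrix of maximum out-forests: $\tilde J_{ij}$ is the total weight of those out-forests with the maximum possible number of arcs in which $j$ belongs to a tree with root $i$, divided by the total weight of all out-forests with the maximum possible number of arcs. Let $P$ be a row-stochastic matrix such that $I-P=\alpha L^{T}$ for some real $\alpha\ne 0$, and let $(X_k)_{k\ge 0}$ be a homogeneous Markov chain on $V$ with transition probability matrix $P$ (where $p_{ij}$ is the probability of transition from $i$ to $j$) whose initial state $X_0$ is uniformly distributed on $V$. Then $x=\frac1n\tilde J\,(1,\dots,1)^{T}$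 is the limiting state distribution of the chain in the sense of Cesàro, i.e. $x$ is a probability vector and $$\lim_{N\to\infty}\frac1N\sum_{k=0}^{N-1}\Pr(X_k=i)=x_i\qquad\text{for every } i\in V.$$ -/

import Mathlib

open Finset Filter Topology MeasureTheory

noncomputable section

/-- A weighted digraph without loops on the vertex set `V`, given by its matrix of arc weights:
the weight of `(i, j)` is zero if there is no such arc and is strictly positive otherwise. -/
structure WeightedDigraph (V : Type*) where
  /-- the matrix of arc weights -/
  w : Matrix V V ℝ
  nonneg : ∀ i j, 0 ≤ w i j
  loopless : ∀ i, w i i = 0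

namespace ArcSet

variable {V : Type*}

/-- Two vertices are joined by a semiwalk of the digraph with arc set `F`. -/
def SemiReachable (F : Finset (V × V)) : V → V → Prop :=
  Relation.ReflTransGen fun a b => (a, b) ∈ F ∨ (b, a) ∈ F

/-- The vertex set of the weak component of `v` in the spanning digraph with arc set `F`. -/
def weakComponent (F : Finset (V × V)) (v : V) : Set V := {u | SemiReachable F v u}

/-- The number of arcs that come in `v`. -/
def indegree [DecidableEq V] (F : Finset (V × V)) (v : V) : ℕ := #{a ∈ F | a.2 = v}

/-- The weak component of `v` is a tree diverging from `r`: it contains `r`, which has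
indegree zero, and its remaining vertices have indegree one. (All arcs coming in a vertex
belong to the weak component of that vertex.) -/
def DivergesFrom [DecidableEq V] (F : Finset (V × V)) (v r : V) : Prop :=
  r ∈ weakComponent F v ∧ indegree F r = 0 ∧
    ∀ u ∈ weakComponent F v, u ≠ r → indegree F u = 1

/-- A diverging forest: every weak component is a diverging tree. -/
def IsDivergingForest [DecidableEq V] (F : Finset (V × V)) : Prop :=
  ∀ v, ∃ r, DivergesFrom F v r

end ArcSet

namespace WeightedDigraph

variable {V : Type*} [Fintype V] [DecidableEq V]

/-- The arc `(i, j)` is present. -/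
def IsArc (G : WeightedDigraph V) (i j : V) : Prop := 0 < G.w i j

/-- The column Laplacian matrix: `l i j = -w i j` for `j ≠ i` and zero column sums. -/
def laplacian (G : WeightedDigraph V) : Matrix V V ℝ :=
  Matrix.of fun i j => if i = j then ∑ k ∈ univ.erase i, G.w k i else - G.w i j

/-- The weight of a spanning subgraph: the product of the weights of its arcs. -/
def weight (G : WeightedDigraph V) (F : Finset (V × V)) : ℝ := ∏ a ∈ F, G.w a.1 a.2

open Classical in
/-- The out-forests (spanning diverging forests) of `G`, each represented by its arc set. -/
def outForests (G : WeightedDigraph V) : Finset (Finset (V × V)) :=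
  {F | (∀ a ∈ F, G.IsArc a.1 a.2) ∧ ArcSet.IsDivergingForest F}

/-- The total weight of the out-forests with `k` arcs. -/
def sigma (G : WeightedDigraph V) (k : ℕ) : ℝ :=
  ∑ F ∈ G.outForests with #F = k, G.weight F

open Classical in
/-- The matrix of out-forests with `k` arcs: its `(i, j)` entry is the total weight of the
out-forests with `k` arcs in which `j` belongs to a tree diverging from `i`. -/
def forestMatrix (G : WeightedDigraph V) (k : ℕ) : Matrix V V ℝ :=
  Matrix.of fun i j =>
    ∑ F ∈ G.outForests with #F = k ∧ ArcSet.DivergesFrom F j i, G.weight F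

/-- The number of arcs in the maximum out-forests of `G` (the number of vertices minus the
out-forest dimension). The supremum is over a nonempty set: there is the arcless forest. -/
def maxForestArcs (G : WeightedDigraph V) : ℕ := G.outForests.sup Finset.card

/-- The stochastic matrix of maximum out-forests. -/
def maxForestStochasticMatrix (G : WeightedDigraph V) : Matrix V V ℝ :=
  (G.sigma G.maxForestArcs)⁻¹ • G.forestMatrix G.maxForestArcs

/-- `G` and a Markov chain with transition probability matrix `P` inversely correspond to each
other: `I - P = α Lᵀ` for some nonzero real `α`. -/
def InverselyCorresponds (G : WeightedDigraph V) (P : Matrix V V ℝ) : Prop :=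
  ∃ α : ℝ, α ≠ 0 ∧ 1 - P = α • G.laplacian.transpose

end WeightedDigraph

/-- `X` is a homogeneous Markov chain with the finite state space `V` and with transition
probability matrix `P` (`P i j` is the probability of transition from `i` to `j`). The Markov
property is written without division, so that it also makes sense for null histories. -/
structure IsHomogeneousMarkovChain {Ω V : Type*} [MeasurableSpace Ω] [Fintype V]
    [DecidableEq V] (μ : Measure Ω) (X : ℕ → Ω → V) (P : Matrix V V ℝ) : Prop where
  stochastic : P ∈ Matrix.rowStochastic ℝ V
  measurable : ∀ k i, MeasurableSet {ω | X k ω = i}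
  markov : ∀ (k : ℕ) (a : ℕ → V) (j : V),
    μ.real {ω | (∀ m ≤ k, X m ω = a m) ∧ X (k + 1) ω = j} =
      μ.real {ω | ∀ m ≤ k, X m ω = a m} * P (a k) j

/-- The distribution of the state at time `k`. -/
def stateDistribution {Ω V : Type*} [MeasurableSpace Ω] (μ : Measure Ω) (X : ℕ → Ω → V)
    (k : ℕ) : V → ℝ := fun i => μ.real {ω | X k ω = i}

/-- `x` is the (Cesàro) limiting state distribution of the chain `X`: it is a probability
vector and the means of the first `N` state distributions tend to it. -/
def IsLimitingStateDistribution {Ω V : Type*} [MeasurableSpace Ω] [Fintype V]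
    (μ : Measure Ω) (X : ℕ → Ω → V) (x : V → ℝ) : Prop :=
  x ∈ stdSimplex ℝ V ∧
    Tendsto (fun N : ℕ => (N : ℝ)⁻¹ • ∑ k ∈ range N, stateDistribution μ X k) atTop (𝓝 x)

end

/-! Write `Q k` for `forestMatrix k` and `σ k` for `sigma k`. Everything rests on `Q k * L = σ (k+1)
• 1 - Q (k+1)` (`forestMatrix_mul_laplacian`), proved by attaching an arc into a root `j` of a
forest. With `d` the maximum number of arcs, the right side vanishes at `k = d`, so `J * L = 0`; at
`k = d - 1` it gives `1 - J = K * L`. Transposed through `1 - P = α • Lᵀ`, these read `P * Jᵀ = Jᵀ`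
and `1 - Jᵀ = (1 - P) * K'`. Hence the state distributions satisfy `d k = d 0 * Jᵀ + (d k - d (k+1))
* K'`. Summing telescopes the last term to a bounded error, which disappears after division by `N`
(`tendsto_cesaro_vecMul`). -/

namespace ArcSet

/-! ### Diverging forests described by tracing arcs back to a root -/

section Roots

variable {V : Type*}

/-- Going backwards along arcs of `F` from `v`, one arrives at `r`, in which no arc comes in. -/
inductive RootOf (F : Finset (V × V)) : V → V → Prop
  | root {v : V} (h : ∀ u, (u, v) ∉ F) : RootOf F v v
  | step {u v r : V} (h : (u, v) ∈ F) (hu : RootOf F u r) : RootOf F v r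

/-- At most one arc comes in each vertex. -/
def InFunctional (F : Finset (V × V)) : Prop :=
  ∀ ⦃a b v⦄, (a, v) ∈ F → (b, v) ∈ F → a = b

/-- At most one arc comes in each vertex, and each vertex is reached from a root. -/
def IsRooted (F : Finset (V × V)) : Prop :=
  InFunctional F ∧ ∀ v, ∃ r, RootOf F v r

variable {F : Finset (V × V)} {u v r s j p : V}

lemma RootOf.isRoot (h : RootOf F v r) : ∀ u, (u, r) ∉ F := by
  induction h with
  | root h => exact h
  | step _ _ ih => exact ih

lemma RootOf.eq_of_isRoot (h : RootOf F v r) (hv : ∀ u, (u, v) ∉ F) : r = v := by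
  cases h with
  | root _ => rfl
  | step h _ => exact absurd h (hv _)

lemma RootOf.of_arc (hF : InFunctional F) (h : RootOf F v r) (ha : (u, v) ∈ F) :
    RootOf F u r := by
  cases h with
  | root h => exact absurd ha (h _)
  | step h hu => rwa [hF ha h]

lemma RootOf.unique (hF : InFunctional F) (h : RootOf F v r) (h' : RootOf F v s) : r = s := by
  induction h with
  | root h => exact (h'.eq_of_isRoot h).symm
  | step h _ ih => exact ih (h'.of_arc hF h)

lemma RootOf.semiReachable (h : RootOf F v r) : SemiReachable F v r := by
  induction h with
  | root _ => exact Relation.ReflTransGen.refl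
  | step h _ ih => exact Relation.ReflTransGen.head (Or.inr h) ih

lemma RootOf.of_semiReachable (hF : InFunctional F) (h : RootOf F v r)
    (hs : SemiReachable F v u) : RootOf F u r := by
  induction hs with
  | refl => exact h
  | tail _ hab ih =>
    rcases hab with hab | hab
    · exact RootOf.step hab ih
    · exact ih.of_arc hF hab

lemma SemiReachable.symm (h : SemiReachable F u v) : SemiReachable F v u := by
  induction h with
  | refl => exact Relation.ReflTransGen.refl
  | tail _ hab ih => exact Relation.ReflTransGen.head hab.symm ih

variable [DecidableEq V]

lemma indegree_eq_zero_iff : indegree F v = 0 ↔ ∀ u, (u, v) ∉ F := by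
  simp only [indegree, card_eq_zero, filter_eq_empty_iff, Prod.forall]
  exact ⟨fun h u hu => h u v hu rfl, fun h a b hab hb => h a (hb ▸ hab)⟩

lemma indegree_le_one_iff :
    indegree F v ≤ 1 ↔ ∀ a b, (a, v) ∈ F → (b, v) ∈ F → a = b := by
  rw [indegree, card_le_one]
  constructor
  · intro h a b ha hb
    exact congrArg Prod.fst (h (a, v) (by simpa using ha) (b, v) (by simpa using hb))
  · rintro h ⟨a, x⟩ ha ⟨b, y⟩ hb
    simp only [mem_filter] at ha hb
    obtain ⟨ha, rfl⟩ := ha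
    obtain ⟨hb, rfl⟩ := hb
    rw [h a b ha hb]

lemma IsDivergingForest.inFunctional (hF : IsDivergingForest F) : InFunctional F := by
  intro a b v
  refine indegree_le_one_iff.1 ?_ a b
  obtain ⟨r, _, hr, h⟩ := hF v
  by_cases hv : v = r
  · subst hv; omega
  · exact (h v Relation.ReflTransGen.refl hv).le

lemma DivergesFrom.rootOf (hF : InFunctional F) (h : DivergesFrom F v r) : RootOf F v r :=
  (RootOf.root (indegree_eq_zero_iff.1 h.2.1)).of_semiReachable hF (SemiReachable.symm h.1)

lemma RootOf.divergesFrom (hF : InFunctional F) (h : RootOf F v r) : DivergesFrom F v r := by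
  refine ⟨h.semiReachable, indegree_eq_zero_iff.2 h.isRoot, fun u hu hur => ?_⟩
  have hle : indegree F u ≤ 1 := indegree_le_one_iff.2 fun a b => @hF a b u
  have hne : indegree F u ≠ 0 := fun h0 =>
    hur ((h.of_semiReachable hF hu).eq_of_isRoot (indegree_eq_zero_iff.1 h0)).symm
  omega

lemma isDivergingForest_iff : IsDivergingForest F ↔ IsRooted F := by
  constructor
  · intro h
    exact ⟨h.inFunctional, fun v => (h v).imp fun _ hr => hr.rootOf h.inFunctional⟩
  · rintro ⟨h, h'⟩ v
    exact (h' v).imp fun _ hr => hr.divergesFrom h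

lemma IsRooted.divergesFrom_iff (hF : IsRooted F) : DivergesFrom F v r ↔ RootOf F v r :=
  ⟨fun h => h.rootOf hF.1, fun h => h.divergesFrom hF.1⟩

lemma RootOf.insert_of_ne (h : RootOf F v r) (hr : r ≠ j) :
    RootOf (insert (p, j) F) v r := by
  induction h with
  | root h => exact RootOf.root fun u => by simp [h u, hr]
  | step h _ ih => exact RootOf.step (mem_insert_of_mem h) (ih hr)

lemma RootOf.insert_of_eq (h : RootOf F v j) (hp : RootOf F p r) (hr : r ≠ j) :
    RootOf (insert (p, j) F) v r := by
  generalize hs : j = s at h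
  induction h with
  | root _ => subst hs; exact RootOf.step (mem_insert_self _ _) (hp.insert_of_ne hr)
  | step h _ ih => exact RootOf.step (mem_insert_of_mem h) (ih hs)

/-- Since `p` lies outside the tree of `j`, the new arc closes no cycle: the whole tree of `j` is
grafted onto the tree of `p` and inherits its root. -/
lemma IsRooted.insert_arc (hF : IsRooted F) (hj : ∀ u, (u, j) ∉ F) (hp : ¬ RootOf F p j) :
    IsRooted (insert (p, j) F) := by
  constructor
  · intro a b v ha hb
    simp only [mem_insert, Prod.mk.injEq] at ha hb
    rcases ha with ⟨rfl, rfl⟩ | ha <;> rcases hb with ⟨rfl, hb⟩ | hb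
    · rfl
    · exact absurd hb (hj _)
    · subst hb; exact absurd ha (hj _)
    · exact hF.1 ha hb
  · intro v
    obtain ⟨r, hr⟩ := hF.2 v
    by_cases hrj : r = j
    · subst hrj
      obtain ⟨s, hs⟩ := hF.2 p
      exact ⟨s, hr.insert_of_eq hs fun h => hp (h ▸ hs)⟩
    · exact ⟨r, hr.insert_of_ne hrj⟩

lemma IsRooted.rootOf_insert_iff_of_rootOf (hF : IsRooted F) (hj : ∀ u, (u, j) ∉ F)
    (hp : ¬ RootOf F p j) (hv : RootOf F v j) :
    RootOf (insert (p, j) F) v r ↔ RootOf F p r := by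
  obtain ⟨s, hs⟩ := hF.2 p
  have hvs : RootOf (insert (p, j) F) v s := hv.insert_of_eq hs fun h => hp (h ▸ hs)
  constructor
  · intro h
    rwa [h.unique (hF.insert_arc hj hp).1 hvs]
  · intro h
    rwa [h.unique hF.1 hs]

lemma IsRooted.rootOf_insert_iff_of_not_rootOf (hF : IsRooted F) (hj : ∀ u, (u, j) ∉ F)
    (hp : ¬ RootOf F p j) (hv : ¬ RootOf F v j) :
    RootOf (insert (p, j) F) v r ↔ RootOf F v r := by
  obtain ⟨s, hs⟩ := hF.2 v
  have hvs : RootOf (insert (p, j) F) v s := hs.insert_of_ne fun h => hv (h ▸ hs)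
  constructor
  · intro h
    rwa [h.unique (hF.insert_arc hj hp).1 hvs]
  · intro h
    rwa [h.unique hF.1 hs]

lemma IsRooted.isRoot_erase (hF : IsRooted F) (hpj : (p, j) ∈ F) (u : V) :
    (u, j) ∉ F.erase (p, j) := by
  intro h
  obtain ⟨hne, h⟩ := mem_erase.1 h
  exact hne (by rw [hF.1 h hpj])

lemma IsRooted.erase_arc (hF : IsRooted F) (hpj : (p, j) ∈ F) : IsRooted (F.erase (p, j)) := by
  refine ⟨fun a b v ha hb => hF.1 (mem_of_mem_erase ha) (mem_of_mem_erase hb), fun v => ?_⟩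
  obtain ⟨r, hr⟩ := hF.2 v
  induction hr with
  | root h => exact ⟨_, RootOf.root fun u hu => h u (mem_of_mem_erase hu)⟩
  | @step u v r h _ ih =>
    by_cases huv : (u, v) = (p, j)
    · obtain ⟨rfl, rfl⟩ := Prod.mk.inj huv
      exact ⟨_, RootOf.root (hF.isRoot_erase hpj)⟩
    · exact ih.imp fun _ hs => RootOf.step (mem_erase.2 ⟨huv, h⟩) hs

/-- Otherwise `(p, j)` would close a cycle in `F`. Tracing back from `p` in `F` would then never
leave the tree of `j`, and so never reach a root of `F`. -/
lemma IsRooted.not_rootOf_erase (hF : IsRooted F) (hpj : (p, j) ∈ F) :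
    ¬ RootOf (F.erase (p, j)) p j := by
  intro hp
  have key : ∀ {v r}, RootOf F v r → ¬ RootOf (F.erase (p, j)) v j := by
    intro v r h
    induction h with
    | root h =>
      intro h'
      have := h'.eq_of_isRoot fun u hu => h u (mem_of_mem_erase hu)
      exact h p (this ▸ hpj)
    | @step u v r h _ ih =>
      intro h'
      cases h' with
      | root _ => exact ih (hF.1 h hpj ▸ hp)
      | step hc hcj => exact ih (hF.1 h (mem_of_mem_erase hc) ▸ hcj)
  obtain ⟨r, hr⟩ := hF.2 p
  exact key hr hp

end Roots

/-! ### Attaching an arc into a root as a bijection -/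

section Counting

variable {V : Type*} [Fintype V] [DecidableEq V]

open Classical in
/-- The diverging forests with `k` arcs on the vertex set `V`. -/
noncomputable def rootedForests (V : Type*) [Fintype V] (k : ℕ) : Finset (Finset (V × V)) :=
  {F | IsRooted F ∧ #F = k}

omit [DecidableEq V] in
lemma mem_rootedForests {F : Finset (V × V)} {k : ℕ} :
    F ∈ rootedForests V k ↔ IsRooted F ∧ #F = k := by
  simp [rootedForests]

open Classical in
/-- A forest in which `j` is not a root arises in exactly one way by adding an arc into `j` to a
forest in which `j` is a root. -/
lemma sum_rootedForests_succ_not_isRoot (j : V) (k : ℕ) (g : Finset (V × V) → ℝ) :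
    ∑ F ∈ rootedForests V (k + 1) with ¬ ∀ u, (u, j) ∉ F, g F =
      ∑ F ∈ rootedForests V k with ∀ u, (u, j) ∉ F,
        ∑ p with ¬ RootOf F p j, g (insert (p, j) F) := by
  rw [Finset.sum_sigma']
  symm
  refine Finset.sum_bij (fun x _ => insert (x.2, j) x.1) ?_ ?_ ?_ (fun _ _ => rfl)
  · rintro ⟨F, p⟩ h
    simp only [mem_sigma, mem_filter, mem_rootedForests, mem_univ, true_and] at h ⊢
    obtain ⟨⟨⟨hF, hk⟩, hj⟩, hp⟩ := h
    refine ⟨⟨hF.insert_arc hj hp, by rw [card_insert_of_notMem (hj p), hk]⟩, fun h => ?_⟩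
    exact h p (mem_insert_self _ _)
  · rintro ⟨F, p⟩ h ⟨F', p'⟩ h' heq
    simp only [mem_sigma, mem_filter, mem_univ, true_and] at h h' heq
    have hpp : p = p' := by
      have : (p, j) ∈ insert (p', j) F' := heq ▸ mem_insert_self _ _
      rcases mem_insert.1 this with h1 | h1
      · exact congrArg Prod.fst h1
      · exact absurd h1 (h'.1.2 p)
    subst hpp
    have hFF : F = F' := by
      rw [← erase_insert (h.1.2 p), heq, erase_insert (h'.1.2 p)]
    subst hFF
    rfl
  · intro F h
    simp only [mem_filter, mem_rootedForests, not_forall, not_not] at h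
    obtain ⟨⟨hF, hk⟩, p, hpj⟩ := h
    refine ⟨⟨F.erase (p, j), p⟩, ?_, insert_erase hpj⟩
    simp only [mem_sigma, mem_filter, mem_rootedForests, mem_univ, true_and]
    refine ⟨⟨⟨hF.erase_arc hpj, ?_⟩, hF.isRoot_erase hpj⟩, hF.not_rootOf_erase hpj⟩
    rw [card_erase_of_mem hpj, hk, Nat.add_sub_cancel]

end Counting

end ArcSet

/-! ### The forest matrices and the Laplacian -/

namespace WeightedDigraph

open ArcSet

variable {V : Type*} [Fintype V] [DecidableEq V] (G : WeightedDigraph V)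

omit [Fintype V] in
lemma weight_insert {F : Finset (V × V)} {p j : V} (h : (p, j) ∉ F) :
    G.weight (insert (p, j) F) = G.w p j * G.weight F := by
  rw [weight, prod_insert h, weight]

omit [Fintype V] [DecidableEq V] in
-- This lets weighted sums run over all diverging forests on `V`, so that the bijection need not
-- check which arcs belong to `G`.
lemma weight_eq_zero {F : Finset (V × V)} (h : ¬ ∀ a ∈ F, G.IsArc a.1 a.2) :
    G.weight F = 0 := by
  push Not at h
  obtain ⟨a, ha, haw⟩ := h
  exact prod_eq_zero ha (le_antisymm (not_lt.1 haw) (G.nonneg _ _))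

lemma mem_outForests {F : Finset (V × V)} :
    F ∈ G.outForests ↔ (∀ a ∈ F, G.IsArc a.1 a.2) ∧ IsRooted F := by
  simp [outForests, isDivergingForest_iff]

lemma sigma_eq_sum_rootedForests (k : ℕ) :
    G.sigma k = ∑ F ∈ rootedForests V k, G.weight F := by
  refine Finset.sum_subset ?_ ?_
  · intro F hF
    rw [mem_filter, mem_outForests] at hF
    exact mem_rootedForests.2 ⟨hF.1.2, hF.2⟩
  · intro F hF hF'
    rw [mem_rootedForests] at hF
    refine G.weight_eq_zero fun h => hF' ?_
    rw [mem_filter, mem_outForests]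
    exact ⟨⟨h, hF.1⟩, hF.2⟩

open Classical in
lemma forestMatrix_eq_sum_rootedForests (k : ℕ) (i j : V) :
    G.forestMatrix k i j =
      ∑ F ∈ rootedForests V k, G.weight F * if RootOf F j i then 1 else 0 := by
  simp only [mul_ite, mul_one, mul_zero]
  rw [← Finset.sum_filter]
  refine Finset.sum_subset ?_ ?_
  · intro F hF
    rw [mem_filter, mem_outForests] at hF
    exact mem_filter.2 ⟨mem_rootedForests.2 ⟨hF.1.2, hF.2.1⟩,
      hF.1.2.divergesFrom_iff.1 hF.2.2⟩
  · intro F hF hF'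
    rw [mem_filter, mem_rootedForests] at hF
    refine G.weight_eq_zero fun h => hF' ?_
    rw [mem_filter, mem_outForests]
    exact ⟨⟨h, hF.1.1⟩, hF.1.2, hF.1.1.divergesFrom_iff.2 hF.2⟩

lemma mul_laplacian_apply (A : Matrix V V ℝ) (i j : V) :
    (A * G.laplacian) i j = ∑ m, G.w m j * (A i j - A i m) := by
  have h : ∀ m, A i m * G.laplacian m j =
      (if m = j then A i j * ∑ l, G.w l j else 0) - A i m * G.w m j := by
    intro m
    by_cases hm : m = j
    · subst hm
      simp only [laplacian, Matrix.of_apply, if_true, G.loopless, mul_zero, sub_zero]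
      rw [Finset.sum_erase univ (f := fun l => G.w l m) (G.loopless m)]
    · simp [laplacian, hm]
  rw [Matrix.mul_apply, Finset.sum_congr rfl fun m _ => h m, Finset.sum_sub_distrib]
  simp only [Finset.sum_ite_eq', mem_univ, if_true, Finset.mul_sum]
  rw [← Finset.sum_sub_distrib]
  exact Finset.sum_congr rfl fun m _ => by ring

open Classical in
-- On the right, forests with root `j` contribute zero; each other one is some `F` plus an arc `(m,
-- j)`, and `j` then acquires the root that `m` has in `F`. On the left, an `m` already in the tree
-- of `j` contributes zero.
lemma sum_isRoot_weight (i j : V) (k : ℕ) :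
    ∑ F ∈ rootedForests V k with ∀ u, (u, j) ∉ F,
        ∑ m, G.w m j * G.weight F *
          ((if RootOf F j i then 1 else 0) - if RootOf F m i then 1 else 0) =
      ∑ F ∈ rootedForests V (k + 1),
        G.weight F * ((if i = j then 1 else 0) - if RootOf F j i then 1 else 0) := by
  have hroot : ∀ F : Finset (V × V), (∀ u, (u, j) ∉ F) → (RootOf F j i ↔ i = j) :=
    fun F hj => ⟨fun h => h.eq_of_isRoot hj, fun h => by rw [h]; exact RootOf.root hj⟩
  rw [← Finset.sum_filter_add_sum_filter_not (rootedForests V (k + 1))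
    (fun F => ∀ u, (u, j) ∉ F), sum_rootedForests_succ_not_isRoot]
  rw [Finset.sum_eq_zero (s := (rootedForests V (k + 1)).filter _), zero_add]
  swap
  · intro F hF
    simp only [hroot F (mem_filter.1 hF).2, sub_self, mul_zero]
  refine Finset.sum_congr rfl fun F hF => ?_
  rw [mem_filter, mem_rootedForests] at hF
  obtain ⟨⟨hF, _⟩, hj⟩ := hF
  rw [Finset.sum_filter]
  refine Finset.sum_congr rfl fun m _ => ?_
  by_cases hm : RootOf F m j
  · have : RootOf F m i ↔ i = j :=
      ⟨fun h => h.unique hF.1 hm, fun h => h ▸ hm⟩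
    simp [hroot F hj, this, hm]
  · simp only [hm, not_false_eq_true, if_true, hroot F hj, G.weight_insert (hj m),
      hF.rootOf_insert_iff_of_rootOf hj hm (RootOf.root hj)]

open Classical in
-- Write the forest as `F` plus `(p, j)`. Every `m` in the old tree of `j` now shares the root of
-- `j` and cancels; the remaining terms are antisymmetric under exchanging `p` and `m`.
lemma sum_not_isRoot_weight (i j : V) (k : ℕ) :
    ∑ F ∈ rootedForests V k with ¬ ∀ u, (u, j) ∉ F,
        ∑ m, G.w m j * G.weight F *
          ((if RootOf F j i then 1 else 0) - if RootOf F m i then 1 else 0) = 0 := by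
  cases k with
  | zero =>
    refine Finset.sum_eq_zero fun F hF => ?_
    rw [mem_filter, mem_rootedForests, card_eq_zero] at hF
    simp [hF.1.2] at hF
  | succ k =>
    rw [sum_rootedForests_succ_not_isRoot]
    refine Finset.sum_eq_zero fun F hF => ?_
    rw [mem_filter, mem_rootedForests] at hF
    obtain ⟨⟨hF, _⟩, hj⟩ := hF
    set S : Finset V := {p | ¬ RootOf F p j} with hS
    have h : ∀ p ∈ S, ∑ m, G.w m j * G.weight (insert (p, j) F) *
        ((if RootOf (insert (p, j) F) j i then 1 else 0) -
          if RootOf (insert (p, j) F) m i then 1 else 0) =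
        ∑ m ∈ S, G.weight F * (G.w m j * G.w p j *
          ((if RootOf F p i then 1 else 0) - if RootOf F m i then 1 else 0)) := by
      intro p hp
      replace hp : ¬ RootOf F p j := by simpa [hS] using hp
      rw [hS, Finset.sum_filter]
      refine Finset.sum_congr rfl fun m _ => ?_
      rw [G.weight_insert (hj p)]
      simp only [hF.rootOf_insert_iff_of_rootOf hj hp (RootOf.root hj)]
      by_cases hm : RootOf F m j
      · simp [hF.rootOf_insert_iff_of_rootOf hj hp hm, hm]
      · simp only [hF.rootOf_insert_iff_of_not_rootOf hj hp hm, hm, not_false_eq_true, if_true]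
        ring
    rw [Finset.sum_congr rfl h]
    have hanti : ∀ f : V → V → ℝ, (∀ p m, f p m = - f m p) →
        ∑ p ∈ S, ∑ m ∈ S, f p m = 0 := by
      intro f hf
      have h1 : ∑ p ∈ S, ∑ m ∈ S, f p m = - ∑ p ∈ S, ∑ m ∈ S, f p m := by
        conv_lhs => rw [Finset.sum_comm]
        simp only [← Finset.sum_neg_distrib]
        exact Finset.sum_congr rfl fun p _ => Finset.sum_congr rfl fun m _ => hf _ _
      linarith
    exact hanti _ fun p m => by ring

/-- The recursion for the matrices of out-forests with a given number of arcs. -/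
theorem forestMatrix_mul_laplacian (k : ℕ) :
    G.forestMatrix k * G.laplacian =
      G.sigma (k + 1) • (1 : Matrix V V ℝ) - G.forestMatrix (k + 1) := by
  classical
  ext i j
  -- The forests with `k` arcs are split by whether `j` is a root.
  have h := congrArg₂ (· + ·) (G.sum_isRoot_weight i j k) (G.sum_not_isRoot_weight i j k)
  simp only [Finset.sum_filter_add_sum_filter_not, add_zero] at h
  rw [mul_laplacian_apply, Matrix.sub_apply, Matrix.smul_apply, Matrix.one_apply,
    sigma_eq_sum_rootedForests, smul_eq_mul]
  simp only [forestMatrix_eq_sum_rootedForests]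
  rw [Finset.sum_mul, ← Finset.sum_sub_distrib]
  simp only [← mul_sub]
  rw [← h, Finset.sum_comm]
  refine Finset.sum_congr rfl fun m _ => ?_
  rw [← Finset.sum_sub_distrib, Finset.mul_sum]
  exact Finset.sum_congr rfl fun F _ => by ring

omit [Fintype V] [DecidableEq V] in
lemma isRooted_empty : IsRooted (∅ : Finset (V × V)) :=
  ⟨fun _ _ _ h => by simp at h, fun v => ⟨v, RootOf.root fun _ => by simp⟩⟩

lemma outForests_nonempty : G.outForests.Nonempty :=
  ⟨∅, G.mem_outForests.2 ⟨by simp, isRooted_empty⟩⟩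

lemma sigma_maxForestArcs_pos : 0 < G.sigma G.maxForestArcs := by
  obtain ⟨F, hF, hcard⟩ := Finset.exists_mem_eq_sup _ G.outForests_nonempty Finset.card
  refine Finset.sum_pos (fun F hF => ?_) ⟨F, mem_filter.2 ⟨hF, hcard.symm⟩⟩
  exact Finset.prod_pos (G.mem_outForests.1 (mem_filter.1 hF).1).1

lemma filter_card_eq_empty : G.outForests.filter (#· = G.maxForestArcs + 1) = ∅ := by
  refine Finset.filter_eq_empty_iff.2 fun F hF h => ?_
  have : #F ≤ G.maxForestArcs := Finset.le_sup (f := Finset.card) hF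
  omega

lemma sigma_succ_maxForestArcs : G.sigma (G.maxForestArcs + 1) = 0 := by
  rw [sigma, filter_card_eq_empty, Finset.sum_empty]

lemma forestMatrix_succ_maxForestArcs : G.forestMatrix (G.maxForestArcs + 1) = 0 := by
  ext i j
  rw [forestMatrix, Matrix.of_apply, ← Finset.filter_filter, filter_card_eq_empty,
    Finset.filter_empty, Finset.sum_empty, Matrix.zero_apply]

lemma forestMatrix_zero : G.forestMatrix 0 = G.sigma 0 • (1 : Matrix V V ℝ) := by
  classical
  ext i j
  rw [Matrix.smul_apply, Matrix.one_apply, sigma_eq_sum_rootedForests, smul_eq_mul,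
    forestMatrix_eq_sum_rootedForests, Finset.sum_mul]
  refine Finset.sum_congr rfl fun F hF => ?_
  obtain rfl := card_eq_zero.1 (mem_rootedForests.1 hF).2
  have hj : ∀ u, (u, j) ∉ (∅ : Finset (V × V)) := by simp
  have : RootOf (∅ : Finset (V × V)) j i ↔ i = j :=
    ⟨fun h => h.eq_of_isRoot hj, fun h => by rw [h]; exact RootOf.root hj⟩
  simp only [this]

theorem maxForestStochasticMatrix_mul_laplacian :
    G.maxForestStochasticMatrix * G.laplacian = 0 := by
  rw [maxForestStochasticMatrix, Matrix.smul_mul, forestMatrix_mul_laplacian,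
    sigma_succ_maxForestArcs, forestMatrix_succ_maxForestArcs]
  simp

theorem exists_one_sub_maxForestStochasticMatrix :
    ∃ K : Matrix V V ℝ, 1 - G.maxForestStochasticMatrix = K * G.laplacian := by
  have hpos := G.sigma_maxForestArcs_pos
  have hone : (1 : Matrix V V ℝ) =
      (G.sigma G.maxForestArcs)⁻¹ • (G.sigma G.maxForestArcs • (1 : Matrix V V ℝ)) := by
    rw [smul_smul, inv_mul_cancel₀ hpos.ne', one_smul]
  rw [hone, maxForestStochasticMatrix, ← smul_sub]
  -- If the maximum is zero, then `J = 1` and there is no preceding forest matrix to use.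
  cases h : G.maxForestArcs with
  | zero => exact ⟨0, by rw [forestMatrix_zero]; simp⟩
  | succ k =>
    exact ⟨(G.sigma (k + 1))⁻¹ • G.forestMatrix k, by
      rw [Matrix.smul_mul, forestMatrix_mul_laplacian]⟩

end WeightedDigraph

/-- If `P * M = M` and `1 - M = (1 - P) * K`, then the Cesàro means of a bounded sequence of
row vectors `d k = d 0 * P ^ k` tend to `d 0 * M`. -/
theorem tendsto_cesaro_vecMul {V : Type*} [Fintype V] [DecidableEq V] {P M K : Matrix V V ℝ}
    (hPM : P * M = M) (hK : 1 - M = (1 - P) * K) {d : ℕ → V → ℝ}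
    (hd : ∀ k, d (k + 1) = Matrix.vecMul (d k) P) (hb : ∀ k i, |d k i| ≤ 1) :
    Tendsto (fun N : ℕ => (N : ℝ)⁻¹ • ∑ k ∈ range N, d k) atTop
      (𝓝 (Matrix.vecMul (d 0) M)) := by
  have hM : ∀ k, Matrix.vecMul (d k) M = Matrix.vecMul (d 0) M := by
    intro k
    induction k with
    | zero => rfl
    | succ k ih => rw [hd, Matrix.vecMul_vecMul, hPM, ih]
  -- This is `d k` applied to `1 - M = (1 - P) * K`, where `d k * (1 - P)` is the difference of
  -- consecutive terms.
  have hstep : ∀ k, d k = Matrix.vecMul (d 0) M + Matrix.vecMul (d k - d (k + 1)) K := by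
    intro k
    have : Matrix.vecMul (d k) (1 - M) = Matrix.vecMul (d k - d (k + 1)) K := by
      rw [hK, ← Matrix.vecMul_vecMul, Matrix.vecMul_sub, Matrix.vecMul_one, hd]
    rw [← this, Matrix.vecMul_sub, Matrix.vecMul_one, hM k]
    abel
  have hsum : ∀ N : ℕ, ∑ k ∈ range N, d k =
      (N : ℝ) • Matrix.vecMul (d 0) M + Matrix.vecMul (d 0 - d N) K := by
    intro N
    induction N with
    | zero => simp
    | succ N ih =>
      have h : d 0 - d (N + 1) = (d 0 - d N) + (d N - d (N + 1)) := by abel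
      rw [Finset.sum_range_succ, ih, h, Matrix.add_vecMul, Nat.cast_succ, add_smul, one_smul]
      have hN := hstep N
      generalize Matrix.vecMul (d N - d (N + 1)) K = z at hN ⊢
      rw [add_assoc, add_assoc, hN]
      abel
  rw [tendsto_pi_nhds]
  intro i
  have hbound : ∀ N, |Matrix.vecMul (d 0 - d N) K i| ≤ ∑ j, 2 * |K j i| := by
    intro N
    refine (Finset.abs_sum_le_sum_abs _ _).trans (Finset.sum_le_sum fun j _ => ?_)
    rw [abs_mul]
    refine mul_le_mul_of_nonneg_right ?_ (abs_nonneg _)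
    refine (abs_sub _ _).trans ?_
    linarith [hb 0 j, hb N j]
  have hz : Tendsto (fun N : ℕ => (N : ℝ)⁻¹ * Matrix.vecMul (d 0 - d N) K i) atTop (𝓝 0) := by
    refine squeeze_zero_norm (a := fun N : ℕ => (N : ℝ)⁻¹ * ∑ j, 2 * |K j i|) (fun N => ?_) ?_
    · rw [norm_mul, Real.norm_eq_abs, Real.norm_eq_abs, abs_of_nonneg (by positivity)]
      exact mul_le_mul_of_nonneg_left (hbound N) (by positivity)
    · simpa using (tendsto_inv_atTop_nhds_zero_nat (𝕜 := ℝ)).mul_const (∑ j, 2 * |K j i|)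
  have hlim := hz.const_add (Matrix.vecMul (d 0) M i)
  rw [add_zero] at hlim
  refine hlim.congr' ?_
  filter_upwards [eventually_gt_atTop 0] with N hN
  have hN' : (N : ℝ) ≠ 0 := by positivity
  rw [hsum N, Pi.smul_apply, Pi.add_apply, Pi.smul_apply, smul_eq_mul, smul_eq_mul, mul_add,
    inv_mul_cancel_left₀ hN']

/-! ### One-step evolution of the state distribution -/

section MarkovChain

variable {Ω V : Type*} [MeasurableSpace Ω] [Fintype V] {μ : Measure Ω} [IsProbabilityMeasure μ]
  {X : ℕ → Ω → V}

lemma measureReal_eq_sum_fibers (hX : ∀ k i, MeasurableSet {ω | X k ω = i}) (s : ℕ)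
    {A : Set Ω} (hA : MeasurableSet A) :
    μ.real A = ∑ b, μ.real (A ∩ {ω | X s ω = b}) := by
  rw [← measureReal_biUnion_finset]
  · congr 1
    ext ω
    simp
  · intro b _ c _ hbc
    refine Set.disjoint_left.2 fun ω hb hc => hbc ?_
    exact hb.2.symm.trans hc.2
  · exact fun b _ => hA.inter (hX s b)

lemma stateDistribution_mem_stdSimplex (hX : ∀ k i, MeasurableSet {ω | X k ω = i}) (k : ℕ) :
    stateDistribution μ X k ∈ stdSimplex ℝ V := by
  refine ⟨fun i => measureReal_nonneg, ?_⟩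
  have h := measureReal_eq_sum_fibers (μ := μ) hX k MeasurableSet.univ
  simp only [Set.univ_inter, probReal_univ] at h
  exact h.symm

variable [DecidableEq V] {P : Matrix V V ℝ}

/-- The Markov property for full histories descends to histories starting at time `s`: summing over
the state at time `s` forgets it. The case `s = k` gives the one-step law. -/
lemma IsHomogeneousMarkovChain.markov_of_le (hX : IsHomogeneousMarkovChain μ X P) (k : ℕ)
    (j : V) {s : ℕ} (hs : s ≤ k) (a : ℕ → V) :
    μ.real {ω | (∀ m, s ≤ m → m ≤ k → X m ω = a m) ∧ X (k + 1) ω = j} =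
      μ.real {ω | ∀ m, s ≤ m → m ≤ k → X m ω = a m} * P (a k) j := by
  induction s generalizing a with
  | zero => simpa using hX.markov k a j
  | succ s ih =>
    have hmeas : MeasurableSet {ω | ∀ m, s + 1 ≤ m → m ≤ k → X m ω = a m} := by
      simp only [Set.ofPred_forall]
      exact MeasurableSet.iInter fun m => MeasurableSet.iInter fun _ =>
        MeasurableSet.iInter fun _ => hX.measurable m (a m)
    rw [measureReal_eq_sum_fibers hX.measurable s hmeas, Finset.sum_mul]
    refine (measureReal_eq_sum_fibers hX.measurable s
      (hmeas.inter (hX.measurable (k + 1) j))).trans ?_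
    refine Finset.sum_congr rfl fun b _ => ?_
    have hset : ∀ ω, (∀ m, s ≤ m → m ≤ k → X m ω = Function.update a s b m) ↔
        (∀ m, s + 1 ≤ m → m ≤ k → X m ω = a m) ∧ X s ω = b := by
      intro ω
      constructor
      · intro h
        refine ⟨fun m hm hmk => ?_, by simpa using h s le_rfl (by omega)⟩
        have := h m (by omega) hmk
        rwa [Function.update_of_ne (by omega)] at this
      · rintro ⟨h, hb⟩ m hm hmk
        rcases hm.eq_or_lt with rfl | hlt
        · simpa using hb
        · rw [Function.update_of_ne (by omega)]
          exact h m hlt hmk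
    have h := ih (by omega) (Function.update a s b)
    simp only [hset] at h
    rw [Function.update_of_ne (by omega)] at h
    rw [show {ω | ∀ m, s + 1 ≤ m → m ≤ k → X m ω = a m} ∩ {ω | X s ω = b} =
      {ω | (∀ m, s + 1 ≤ m → m ≤ k → X m ω = a m) ∧ X s ω = b} from rfl, ← h]
    congr 1
    ext ω
    simp only [Set.mem_inter_iff, Set.mem_ofPred_eq]
    tauto

lemma IsHomogeneousMarkovChain.stateDistribution_succ (hX : IsHomogeneousMarkovChain μ X P)
    (k : ℕ) : stateDistribution μ X (k + 1) = Matrix.vecMul (stateDistribution μ X k) P := by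
  ext j
  rw [stateDistribution, measureReal_eq_sum_fibers hX.measurable k (hX.measurable (k + 1) j)]
  refine Finset.sum_congr rfl fun b _ => ?_
  have h := hX.markov_of_le k j le_rfl fun _ => b
  have hk : ∀ ω, (∀ m, k ≤ m → m ≤ k → X m ω = b) ↔ X k ω = b := fun ω =>
    ⟨fun h => h k le_rfl le_rfl, fun h m h1 h2 => by rwa [le_antisymm h2 h1]⟩
  simp only [hk] at h
  rw [stateDistribution, ← h]
  congr 1
  ext ω
  exact and_comm

end MarkovChain

theorem corollary1 {V : Type*} [Fintype V] [DecidableEq V] [Nonempty V]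
    (G : WeightedDigraph V) (P : Matrix V V ℝ) (hGP : G.InverselyCorresponds P)
    {Ω : Type*} [MeasurableSpace Ω] (μ : Measure Ω) [IsProbabilityMeasure μ]
    (X : ℕ → Ω → V) (hX : IsHomogeneousMarkovChain μ X P)
    (hunif : ∀ i, stateDistribution μ X 0 i = 1 / (Fintype.card V : ℝ)) :
    IsLimitingStateDistribution μ X
      ((1 / (Fintype.card V : ℝ)) • G.maxForestStochasticMatrix.mulVec (fun _ => 1)) := by
  obtain ⟨α, hα, hP⟩ := hGP
  obtain ⟨K, hK⟩ := G.exists_one_sub_maxForestStochasticMatrix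
  set J := G.maxForestStochasticMatrix
  have hPJ : P * J.transpose = J.transpose := by
    have h : (1 - P) * J.transpose = 0 := by
      rw [hP, Matrix.smul_mul, ← Matrix.transpose_mul,
        G.maxForestStochasticMatrix_mul_laplacian, Matrix.transpose_zero, smul_zero]
    rw [sub_mul, one_mul, sub_eq_zero] at h
    exact h.symm
  have hK' : 1 - J.transpose = (1 - P) * (α⁻¹ • K.transpose) := by
    rw [hP, Matrix.smul_mul, Matrix.mul_smul, smul_smul, mul_inv_cancel₀ hα, one_smul,
      ← Matrix.transpose_mul, ← hK, Matrix.transpose_sub, Matrix.transpose_one]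
  have hmem := stateDistribution_mem_stdSimplex (μ := μ) hX.measurable
  have hb : ∀ k i, |stateDistribution μ X k i| ≤ 1 := fun k i => by
    rw [abs_of_nonneg ((hmem k).1 i)]
    exact measureReal_le_one
  have hlim := tendsto_cesaro_vecMul hPJ hK' hX.stateDistribution_succ hb
  have hx : Matrix.vecMul (stateDistribution μ X 0) J.transpose =
      (1 / (Fintype.card V : ℝ)) • J.mulVec (fun _ => 1) := by
    rw [Matrix.vecMul_transpose, ← Matrix.mulVec_smul]
    congr 1
    ext i
    simp [hunif i]
  rw [hx] at hlim
  -- For `N > 0` the Cesàro means are convex combinations of probability vectors, and the simplex is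
  -- closed.
  refine ⟨(isClosed_stdSimplex ℝ V).mem_of_tendsto hlim ?_, hlim⟩
  filter_upwards [eventually_gt_atTop 0] with N hN
  rw [Finset.smul_sum]
  refine (convex_stdSimplex ℝ V).sum_mem (fun _ _ => by positivity) ?_ fun k _ => hmem k
  have hN' : (N : ℝ) ≠ 0 := by positivity
  simp [hN']
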